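/- Let $X$ be a separable real Banach space that is (isometrically identified with) the dual of a Banach space $X_*$, let $d\in\mathbb N$, let $S\subset\mathbb R^d$ be a non-empty compact set, and let $J\colon X\times S\to[0,+\infty]$ be Borel measurable such that: (H1) for every $s\in S$, $J(\cdot,s)$ is proper, convex and positively one-homogeneous, i.e. $J(\lambda v,s)=\lambda J(v,s)$ for all $\lambda\ge 0$, $v\in X$ (with $0\cdot\infty=0$); (H2) $J$ is sequentially lower semicontinuous on $X\times S$, where $X$ carries the weak* topology; (H3) there is $C>0$ with $\|v\|_X\le C\,J(v,s)$ for all $v\in X$, $s\in S$. Let $\mathcal M(S;X)$ be the space of countably additive $X$-valued Borel measures on $S$ of finite total variation. For $\mu\in\mathcal M(S;X)$ let $|\mu|$ be its variation measure and $\frac{\mu}{|\mu|}\in L^1((S,|\mu|);X)$ its density, $\mu(E)=\int_E\frac{\mu}{|\mu|}\,d|\mu|$ for all Borel $E\subset S$ (it exists because separable dual spaces have the Radon--Nikodým property), and put $$\hat F(\mu)=\int_S J\Big(\frac{\mu}{|\mu|}(s),s\Big)\,d|\mu|(s).$$ Let $\alpha>0$, $B=\{\mu\in\mathcal M(S;X):\alpha\hat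 F(\mu)\le 1\}$ and $B_r=\{v\in X:\alpha J(v,r)\le 1\}$ for $r\in S$. Denote by $\mathrm{Ext}$ the set of extremal points of a convex set, and by $v\delta_r$ the measure $E\mapsto v$ if $r\in E$, $0$ otherwise. Then: 1. If $0\in\mathrm{Ext}(B_r)$ for each $r\in S$, then $\mathrm{Ext}(B)=\{v\delta_r: r\in S,\ v\in\mathrm{Ext}(B_r)\}$. 2. If there exists $r\in S$ such that $0\notin\mathrm{Ext}(B_r)$, then $\mathrm{Ext}(B)=\{v\delta_r: r\in S,\ v\in\mathrm{Ext}(B_r)\smallsetminus\{0\}\}$. -/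

import Mathlib

open MeasureTheory Filter Topology
open scoped ENNReal NNReal

noncomputable section

namespace InfConv

/-- Weak* convergence of a sequence in a Banach space `X` that is identified with the dual of the
Banach space `E` through `e`: pointwise convergence on the predual `E`. -/
def WeakStarTendsto {E X : Type*} [NormedAddCommGroup E] [NormedSpace ℝ E]
    [NormedAddCommGroup X] [NormedSpace ℝ X] (e : X ≃ₗᵢ[ℝ] StrongDual ℝ E)
    (v : ℕ → X) (w : X) : Prop :=
  ∀ p : E, Tendsto (fun n => e (v n) p) atTop (𝓝 (e w p))

variable {Ω X : Type*} [MeasurableSpace Ω] [NormedAddCommGroup X] [NormedSpace ℝ X]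

/-- The space `M(Ω; X)` of `X`-valued (norm countably additive) measures of finite total
variation. -/
def finiteVariationMeasures (Ω X : Type*) [MeasurableSpace Ω] [NormedAddCommGroup X] :
    Set (VectorMeasure Ω X) :=
  {μ | μ.variation Set.univ < ∞}

/-- `u` is a density of the vector measure `μ` with respect to its variation `|μ|`: it is Bochner
integrable for `|μ|` and `μ(A) = ∫_A u d|μ|` for every measurable `A`. -/
def IsPolarDensity (μ : VectorMeasure Ω X) (u : Ω → X) : Prop :=
  Integrable u μ.variation ∧ ∀ A, MeasurableSet A → μ A = ∫ s in A, u s ∂μ.variation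

open Classical in
/-- The density `μ / |μ|`, which is determined up to `|μ|`-null sets. The value `0` in the absence
of a density is never used for a measure of finite variation when `X` is a separable dual space
(such a space has the Radon-Nikodym property). -/
def polarDensity (μ : VectorMeasure Ω X) : Ω → X :=
  if h : ∃ u, IsPolarDensity μ u then h.choose else 0

/-- The lifted functional `∫ J((μ/|μ|)(s), s) d|μ|(s)`. -/
def lifted (J : X → Ω → ℝ≥0∞) (μ : VectorMeasure Ω X) : ℝ≥0∞ :=
  ∫⁻ s, J (polarDensity μ s) s ∂μ.variation

/-- The unit ball of `α` times the lifted functional, in the space of `X`-valued measures of finite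
variation. -/
def liftedBall (α : ℝ) (J : X → Ω → ℝ≥0∞) : Set (VectorMeasure Ω X) :=
  {μ ∈ finiteVariationMeasures Ω X | ENNReal.ofReal α * lifted J μ ≤ 1}

/-- The unit ball of `α J(·, s)`. -/
def ball (α : ℝ) (J : X → Ω → ℝ≥0∞) (s : Ω) : Set X :=
  {v | ENNReal.ofReal α * J v s ≤ 1}

end InfConv

end

/-! By homogeneity, `∫ J(w(s), s) dm` is the value of the lifted functional at `w m` for any
integrable density `w`. Hence it is positively homogeneous, additive over restrictions to
complementary sets, and equal to `J v r` at the Dirac mass `v δ_r`; coercivity makes it vanish only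
at `0`. A nonzero extreme point `μ` has gauge one, so `m(A)`, the gauge of `μ` restricted to `A`,
defines a probability measure. If `0 < m(A) < 1`, then `μ` is a proper convex combination of its two
normalised restrictions. So `m` takes only the values `0` and `1`, is a point mass, and `μ = v δ_r`.
Conversely, the atom at `r` of an element of the lifted ball lies in the ball at `r`. If `v δ_r` is
interior to a segment, with `v ≠ 0` extreme, both endpoints have atom `v`, which exhausts the gauge
and leaves nothing off `r`. The two cases differ only in whether `0` is extreme. This happens when
no nonzero direction has `J` finite on both sides, a condition passed pointwise through densities,
which exist by the Radon-Nikodym property. -/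

namespace InfConv

/-! ### The Radon-Nikodym property of separable duals -/

section RadonNikodym

variable {E X Ω : Type*} [NormedAddCommGroup E] [NormedSpace ℝ E]

/-- A normed space with separable dual is separable. -/
theorem separableSpace_of_dual [TopologicalSpace.SeparableSpace (StrongDual ℝ E)] :
    TopologicalSpace.SeparableSpace E := by
  obtain ⟨x, hx⟩ := TopologicalSpace.exists_dense_seq (StrongDual ℝ E)
  have hp : ∀ n, ∃ p : E, ‖p‖ ≤ 1 ∧ ‖x n‖ / 2 ≤ |x n p| := by
    intro n
    by_cases h0 : ‖x n‖ = 0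
    · exact ⟨0, by simp, by simp [h0]⟩
    · have hpos : 0 < ‖x n‖ := lt_of_le_of_ne (norm_nonneg _) (Ne.symm h0)
      obtain ⟨p, hp1, hp2⟩ := ContinuousLinearMap.exists_lt_apply_of_lt_opNorm (x n)
        (show ‖x n‖ / 2 < ‖x n‖ by linarith)
      exact ⟨p, hp1.le, hp2.le⟩
  choose p hp1 hp2 using hp
  let V : Submodule ℝ E := (Submodule.span ℝ (Set.range p)).topologicalClosure
  have hV : V = ⊤ := by
    by_contra hne
    obtain ⟨y, hy⟩ : ∃ y, y ∉ V := by
      by_contra! h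
      exact hne (eq_top_iff.2 fun z _ => h z)
    obtain ⟨f, u, hf1, hf2⟩ := geometric_hahn_banach_closed_point (V.convex)
      (Submodule.isClosed_topologicalClosure _) hy
    have hfV : ∀ z ∈ V, f z = 0 := by
      intro z hz
      by_contra hfz
      -- This multiple of `z` has `f`-value `u + 1`, which exceeds the bound `u` on `V`.
      have := hf1 (((u + 1) / f z) • z) (V.smul_mem _ hz)
      rw [map_smul, smul_eq_mul, div_mul_cancel₀ _ hfz] at this
      linarith
    have hf0 : f ≠ 0 := by
      rintro rfl
      have := hf1 0 V.zero_mem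
      simp at this hf2
      linarith
    have hfp : 0 < ‖f‖ := norm_pos_iff.2 hf0
    -- Since `f` kills `p n`, `‖x n‖ / 2 ≤ ‖f - x n‖ < ‖f‖ / 4`, whereas closeness to `f` gives `‖x
    -- n‖ > 3‖f‖ / 4`.
    obtain ⟨n, hn⟩ := hx.exists_dist_lt f (show 0 < ‖f‖ / 4 by linarith)
    rw [dist_eq_norm] at hn
    have h1 : |x n (p n)| ≤ ‖f - x n‖ := by
      have hz : f (p n) = 0 :=
        hfV _ (Submodule.le_topologicalClosure _ (Submodule.subset_span ⟨n, rfl⟩))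
      have := (f - x n).le_opNorm (p n)
      rw [_root_.sub_apply, hz, zero_sub, norm_neg, Real.norm_eq_abs] at this
      exact this.trans (mul_le_of_le_one_right (norm_nonneg _) (hp1 n))
    have h2 : ‖f‖ - ‖f - x n‖ ≤ ‖x n‖ := by
      have := norm_sub_norm_le f (f - x n)
      simpa using this
    have := hp2 n
    linarith
  have hsep : TopologicalSpace.IsSeparable (V : Set E) :=
    ((Set.countable_range p).isSeparable.span).closure
  rw [hV] at hsep
  exact TopologicalSpace.isSeparable_univ_iff.1 hsep

/-- Values `c i` prescribed on a sequence `q i` extend to a functional of norm at most `1` as soon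
as the norm bound holds for rational linear combinations. -/
theorem exists_dual_of_rat_bound (q : ℕ → E) (c : ℕ → ℝ)
    (h : ∀ n (a : Fin n → ℚ), |∑ i, (a i : ℝ) * c i| ≤ ‖∑ i, (a i : ℝ) • q i‖) :
    ∃ φ : StrongDual ℝ E, ‖φ‖ ≤ 1 ∧ ∀ i, φ (q i) = c i := by
  have hreal : ∀ n (a : Fin n → ℝ), |∑ i, a i * c i| ≤ ‖∑ i, a i • q i‖ := by
    intro n a
    have hd : DenseRange (Pi.map (fun (_ : Fin n) (r : ℚ) => (r : ℝ))) :=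
      DenseRange.piMap fun _ => Rat.denseRange_cast
    refine hd.induction_on (p := fun a : Fin n → ℝ => |∑ i, a i * c i| ≤ ‖∑ i, a i • q i‖) a ?_ ?_
    · exact isClosed_le (by fun_prop) (by fun_prop)
    · exact fun r => h n r
  let T : (ℕ →₀ ℝ) →ₗ[ℝ] E := Finsupp.linearCombination ℝ q
  let L : (ℕ →₀ ℝ) →ₗ[ℝ] ℝ := Finsupp.linearCombination ℝ c
  have hTL : ∀ a, |L a| ≤ ‖T a‖ := by
    intro a
    obtain ⟨n, hn⟩ : ∃ n, a.support ⊆ Finset.range n := a.support.exists_nat_subset_range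
    have := hreal n (fun i => a i)
    rw [Fin.sum_univ_eq_sum_range (fun i => a i * c i),
      Fin.sum_univ_eq_sum_range (fun i => a i • q i)] at this
    simp only [T, L, Finsupp.linearCombination_apply]
    rwa [Finsupp.sum_of_support_subset a hn _ (by simp),
      Finsupp.sum_of_support_subset a hn _ (by simp)]
  -- The bound puts the kernel of `T` inside that of `L`, so `L ∘ g` does not depend on the section
  -- `g`.
  obtain ⟨g, hg⟩ := T.rangeRestrict.exists_rightInverse_of_surjective T.range_rangeRestrict
  have hTg : ∀ y : LinearMap.range T, T (g y) = y := fun y =>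
    congrArg Subtype.val (LinearMap.congr_fun hg y)
  let ψ : StrongDual ℝ (LinearMap.range T) := (L ∘ₗ g).mkContinuous 1 fun y => by
    have := hTL (g y)
    rw [hTg] at this
    simpa using this
  obtain ⟨φ, hφ, hnorm⟩ := exists_extension_norm_eq _ ψ
  refine ⟨φ, hnorm ▸ LinearMap.mkContinuous_norm_le _ zero_le_one _, fun i => ?_⟩
  have hTi : T (Finsupp.single i 1) = q i := by simp [T]
  have hLi : L (Finsupp.single i 1) = c i := by simp [L]
  let y : LinearMap.range T := ⟨q i, ⟨_, hTi⟩⟩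
  have hy := hφ y
  have h0 : L (g y - Finsupp.single i 1) = 0 := by
    have := hTL (g y - Finsupp.single i 1)
    rw [map_sub T, hTg, hTi, sub_self, norm_zero] at this
    exact abs_nonpos_iff.1 this
  rw [map_sub, hLi, sub_eq_zero] at h0
  exact hy.trans h0

/-- For a vector measure of finite variation in a dual space, the evaluation at a point of the
predual has a density with respect to the variation. -/
theorem exists_measurable_scalar_density [NormedAddCommGroup X] [NormedSpace ℝ X]
    [MeasurableSpace Ω] (e : X ≃ₗᵢ[ℝ] StrongDual ℝ E) (μ : VectorMeasure Ω X)
    [IsFiniteMeasure μ.variation] (p : E) :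
    ∃ f : Ω → ℝ, Measurable f ∧ Integrable f μ.variation ∧
      ∀ A, MeasurableSet A → e (μ A) p = ∫ s in A, f s ∂μ.variation := by
  let ev : X →L[ℝ] ℝ := (ContinuousLinearMap.apply ℝ ℝ p).comp
    (e.toContinuousLinearEquiv : X →L[ℝ] StrongDual ℝ E)
  let ν : SignedMeasure Ω := μ.mapRange (ev : X →+ ℝ) ev.continuous
  have hν : ∀ A, ν A = e (μ A) p := fun A => rfl
  have hac : ν ≪ᵥ μ.variation.toENNRealVectorMeasure := by
    intro A hA
    have h0 : μ A = 0 := μ.absolutelyContinuous hA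
    rw [hν, h0]
    simp
  refine ⟨ν.rnDeriv μ.variation, SignedMeasure.measurable_rnDeriv _ _,
    SignedMeasure.integrable_rnDeriv _ _, fun A hA => ?_⟩
  rw [← hν, ← withDensityᵥ_apply (SignedMeasure.integrable_rnDeriv _ _) hA,
    SignedMeasure.withDensityᵥ_rnDeriv_eq _ _ hac]

/-- A real function whose integrals over measurable sets are dominated by `c` times the measure is
almost everywhere bounded by `c`. -/
theorem ae_abs_le_of_abs_setIntegral_le [MeasurableSpace Ω] {m : Measure Ω} [IsFiniteMeasure m]
    {g : Ω → ℝ} (hg : Integrable g m) {c : ℝ}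
    (h : ∀ A, MeasurableSet A → |∫ s in A, g s ∂m| ≤ c * m.real A) : ∀ᵐ s ∂m, |g s| ≤ c := by
  have h1 : g ≤ᵐ[m] fun _ => c :=
    ae_le_of_forall_setIntegral_le hg (integrable_const c) fun A hA _ => by
      simpa [mul_comm] using (le_abs_self _).trans (h A hA)
  have h2 : (fun s => -g s) ≤ᵐ[m] fun _ => c :=
    ae_le_of_forall_setIntegral_le hg.neg (integrable_const c) fun A hA _ => by
      rw [integral_neg]
      simpa [mul_comm] using (neg_le_abs _).trans (h A hA)
  filter_upwards [h1, h2] with s h1 h2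
  exact abs_le'.2 ⟨h1, h2⟩

/-- Separable dual spaces have the Radon-Nikodym property: a vector measure of finite variation has
a density with respect to its variation. -/
theorem exists_isPolarDensity [NormedAddCommGroup X] [NormedSpace ℝ X] [CompleteSpace X]
    [TopologicalSpace.SeparableSpace X] [MeasurableSpace X] [BorelSpace X] [MeasurableSpace Ω]
    (e : X ≃ₗᵢ[ℝ] StrongDual ℝ E) (μ : VectorMeasure Ω X) (hμ : μ ∈ finiteVariationMeasures Ω X) :
    ∃ u, IsPolarDensity μ u := by
  have : IsFiniteMeasure μ.variation := ⟨hμ⟩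
  have : TopologicalSpace.SeparableSpace (StrongDual ℝ E) :=
    e.surjective.denseRange.separableSpace e.continuous
  have : TopologicalSpace.SeparableSpace E := separableSpace_of_dual
  have : SecondCountableTopology X := UniformSpace.secondCountable_of_separable X
  obtain ⟨q, hq⟩ := TopologicalSpace.exists_dense_seq E
  choose f hfm hfi hf using fun i => exists_measurable_scalar_density e μ (q i)
  have hbound : ∀ᵐ s ∂μ.variation, ∀ n (a : Fin n → ℚ),
      |∑ i, (a i : ℝ) * f i s| ≤ ‖∑ i, (a i : ℝ) • q i‖ := by
    refine ae_all_iff.2 fun n => ae_all_iff.2 fun a => ?_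
    have hint : ∀ i ∈ Finset.univ, Integrable (fun s => (a i : ℝ) * f i s) μ.variation :=
      fun i _ => (hfi i).const_mul _
    refine ae_abs_le_of_abs_setIntegral_le (integrable_finsetSum _ hint) fun A hA => ?_
    have : ∫ s in A, ∑ i : Fin n, (a i : ℝ) * f i s ∂μ.variation
        = e (μ A) (∑ i, (a i : ℝ) • q i) := by
      rw [integral_finsetSum _ fun i hi => (hint i hi).integrableOn, map_sum]
      refine Finset.sum_congr rfl fun i _ => ?_
      rw [integral_const_mul, map_smul, hf i A hA, smul_eq_mul]
    rw [this, mul_comm]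
    refine ((e (μ A)).le_opNorm _).trans ?_
    rw [e.norm_map]
    exact mul_le_mul_of_nonneg_right VectorMeasure.norm_measure_le_variation (norm_nonneg _)
  -- A measurable set of full measure; setting `u` to `0` off it makes `u` measurable and bounded
  -- everywhere.
  let G : Set Ω := {s | ∀ n (a : Fin n → ℚ),
    |∑ i, (a i : ℝ) * f i s| ≤ ‖∑ i, (a i : ℝ) • q i‖}
  have hGm : MeasurableSet G := by
    simp only [G, Set.ofPred_forall]
    refine MeasurableSet.iInter fun n => MeasurableSet.iInter fun a => ?_
    exact measurableSet_le (by fun_prop) measurable_const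
  have hex : ∀ s, ∃ x : X, ‖x‖ ≤ 1 ∧ ∀ i, e x (q i) = G.indicator (f i) s := by
    intro s
    by_cases hs : s ∈ G
    · obtain ⟨φ, h1, h2⟩ := exists_dual_of_rat_bound q (fun i => f i s) hs
      exact ⟨e.symm φ, by simpa using h1, fun i => by simp [hs, h2]⟩
    · exact ⟨0, by simp, fun i => by simp [hs]⟩
  choose u hu1 hu2 using hex
  let Φ : X → ℕ → ℝ := fun x i => e x (q i)
  have hΦc : Continuous Φ := continuous_pi fun i =>
    (ContinuousLinearMap.apply ℝ ℝ (q i)).continuous.comp e.continuous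
  have hΦi : Function.Injective Φ := by
    intro x y hxy
    apply e.injective
    ext p
    exact congrFun (hq.equalizer (e x).continuous (e y).continuous (funext fun i => congrFun hxy i)) p
  have hum : Measurable u := by
    -- Lusin-Souslin: a continuous injection of a Polish space is a measurable embedding, so
    -- measurable coordinates suffice for norm measurability.
    rw [← (hΦc.measurableEmbedding hΦi).measurable_comp_iff]
    refine measurable_pi_iff.2 fun i => ?_
    have : (fun s => (Φ ∘ u) s i) = G.indicator (f i) := funext fun s => hu2 s i
    rw [this]
    exact (hfm i).indicator hGm
  have hui : Integrable u μ.variation :=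
    Integrable.of_bound hum.aestronglyMeasurable 1 (Eventually.of_forall hu1)
  refine ⟨u, hui, fun A hA => hΦi (funext fun i => ?_)⟩
  let ev : X →L[ℝ] ℝ := (ContinuousLinearMap.apply ℝ ℝ (q i)).comp
    (e.toContinuousLinearEquiv : X →L[ℝ] StrongDual ℝ E)
  change e (μ A) (q i) = ev (∫ s in A, u s ∂μ.variation)
  rw [← ev.integral_comp_comm hui.integrableOn, hf i A hA]
  refine integral_congr_ae (ae_restrict_of_ae ?_)
  filter_upwards [hbound] with s hs
  have hs' : s ∈ G := hs
  change f i s = e (u s) (q i)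
  rw [hu2, Set.indicator_of_mem hs']

end RadonNikodym

theorem apply_smul_of_nonneg {Ω X : Type*} [AddCommGroup X] [Module ℝ X] {J : X → Ω → ℝ≥0∞}
    (hJhom : ∀ (c : ℝ≥0) (v : X) (s : Ω), J (c • v) s = c * J v s)
    {c : ℝ} (hc : 0 ≤ c) (v : X) (s : Ω) : J (c • v) s = ENNReal.ofReal c * J v s := by
  rw [ENNReal.ofReal, ← hJhom, NNReal.smul_def, Real.coe_toNNReal c hc]

/-! ### Restrictions and Dirac masses -/

section VectorMeasure

variable {Ω X : Type*} [MeasurableSpace Ω] [NormedAddCommGroup X] {μ : VectorMeasure Ω X}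

theorem restrict_mem_finiteVariationMeasures (hμ : μ ∈ finiteVariationMeasures Ω X) (A : Set Ω) :
    μ.restrict A ∈ finiteVariationMeasures Ω X := by
  have : IsFiniteMeasure μ.variation := ⟨hμ⟩
  exact measure_lt_top _ _

theorem dirac_mem_finiteVariationMeasures (r : Ω) (v : X) :
    VectorMeasure.dirac r v ∈ finiteVariationMeasures Ω X :=
  measure_lt_top (VectorMeasure.dirac r v).variation _

theorem restrict_add_restrict_compl (μ : VectorMeasure Ω X) {A : Set Ω} (hA : MeasurableSet A) :
    μ.restrict A + μ.restrict Aᶜ = μ := by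
  ext t ht
  rw [_root_.add_apply, VectorMeasure.restrict_apply _ hA ht,
    VectorMeasure.restrict_apply _ hA.compl ht, ← VectorMeasure.of_union _ (ht.inter hA)
    (ht.inter hA.compl), Set.inter_union_compl]
  exact (disjoint_compl_right.mono Set.inter_subset_right Set.inter_subset_right)

theorem restrict_singleton [MeasurableSingletonClass Ω] (μ : VectorMeasure Ω X) (r : Ω) :
    μ.restrict {r} = VectorMeasure.dirac r (μ {r}) := by
  ext t ht
  rw [VectorMeasure.restrict_apply _ (measurableSet_singleton r) ht]
  by_cases h : r ∈ t
  · rw [VectorMeasure.dirac_apply_of_mem ht h, Set.inter_eq_right.2 (Set.singleton_subset_iff.2 h)]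
  · rw [VectorMeasure.dirac_apply_of_notMem h, Set.inter_singleton_eq_empty.2 h,
      VectorMeasure.empty]

theorem dirac_add (r : Ω) (v w : X) :
    VectorMeasure.dirac r (v + w) = VectorMeasure.dirac r v + VectorMeasure.dirac r w := by
  ext t ht
  by_cases h : r ∈ t <;> simp [h, ht]

end VectorMeasure

/-! ### Calculus of the lifted functional -/

section Lifted

variable {Ω X : Type*} [MeasurableSpace Ω] [NormedAddCommGroup X] [NormedSpace ℝ X]
  {J : X → Ω → ℝ≥0∞} {μ : VectorMeasure Ω X}

theorem IsPolarDensity.withDensityᵥ_eq {u : Ω → X} (h : IsPolarDensity μ u) :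
    μ.variation.withDensityᵥ u = μ := by
  ext A hA
  rw [withDensityᵥ_apply h.1 hA, h.2 A hA]

theorem isPolarDensity_polarDensity (h : ∃ u, IsPolarDensity μ u) :
    IsPolarDensity μ (polarDensity μ) := by
  rw [polarDensity, dif_pos h]
  exact h.choose_spec

theorem smul_mem_finiteVariationMeasures (hμ : μ ∈ finiteVariationMeasures Ω X) (c : ℝ) :
    c • μ ∈ finiteVariationMeasures Ω X := by
  have : IsFiniteMeasure μ.variation := ⟨hμ⟩
  exact measure_lt_top _ _

theorem eq_zero_of_polarDensity_ae_eq_zero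
    (hRN : ∀ μ ∈ finiteVariationMeasures Ω X, ∃ u, IsPolarDensity μ u)
    (hμ : μ ∈ finiteVariationMeasures Ω X) (h : ∀ᵐ s ∂μ.variation, polarDensity μ s = 0) :
    μ = 0 := by
  rw [← (isPolarDensity_polarDensity (hRN μ hμ)).withDensityᵥ_eq,
    WithDensityᵥEq.congr_ae (g := 0) h, withDensityᵥ_zero]

section

variable [MeasurableSpace X] [BorelSpace X]

theorem aemeasurable_apply_polarDensity
    (hRN : ∀ μ ∈ finiteVariationMeasures Ω X, ∃ u, IsPolarDensity μ u)
    (hJmeas : Measurable fun p : X × Ω => J p.1 p.2)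
    (hμ : μ ∈ finiteVariationMeasures Ω X) (c : ℝ) :
    AEMeasurable (fun s => J (c • polarDensity μ s) s) μ.variation :=
  hJmeas.comp_aemeasurable
    (((isPolarDensity_polarDensity (hRN μ hμ)).1.1.aemeasurable.const_smul c).prodMk
      aemeasurable_id)

theorem eq_zero_of_lifted_eq_zero
    (hRN : ∀ μ ∈ finiteVariationMeasures Ω X, ∃ u, IsPolarDensity μ u)
    (hJmeas : Measurable fun p : X × Ω => J p.1 p.2) (hJ0 : ∀ v s, J v s = 0 → v = 0)
    (hμ : μ ∈ finiteVariationMeasures Ω X) (h : lifted J μ = 0) : μ = 0 := by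
  have hm := aemeasurable_apply_polarDensity hRN hJmeas hμ 1
  simp only [one_smul] at hm
  refine eq_zero_of_polarDensity_ae_eq_zero hRN hμ ?_
  filter_upwards [(lintegral_eq_zero_iff' hm).1 h] with s hs using hJ0 _ _ hs

end

variable [CompleteSpace X]

theorem withDensityᵥ_mem_finiteVariationMeasures {m : Measure Ω} {w : Ω → X}
    (hw : Integrable w m) : m.withDensityᵥ w ∈ finiteVariationMeasures Ω X := by
  change (m.withDensityᵥ w).variation Set.univ < ∞
  rw [Measure.variation_withDensityᵥ hw, withDensity_apply _ MeasurableSet.univ,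
    Measure.restrict_univ]
  exact hw.2

theorem dirac_eq_withDensityᵥ [MeasurableSingletonClass Ω] (r : Ω) (v : X) :
    VectorMeasure.dirac r v = (Measure.dirac r).withDensityᵥ fun _ => v := by
  classical
  ext A hA
  rw [withDensityᵥ_apply (integrable_const v) hA, setIntegral_dirac]
  by_cases h : r ∈ A <;> simp [h, hA]

variable [MeasurableSpace X] [BorelSpace X]

/-- The lifted functional of a measure given by a density with respect to any measure. -/
theorem lifted_withDensityᵥ (hRN : ∀ μ ∈ finiteVariationMeasures Ω X, ∃ u, IsPolarDensity μ u)
    (hJmeas : Measurable fun p : X × Ω => J p.1 p.2)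
    (hJhom : ∀ (c : ℝ≥0) (v : X) (s : Ω), J (c • v) s = c * J v s)
    {m : Measure Ω} {w : Ω → X} (hw : Integrable w m) :
    lifted J (m.withDensityᵥ w) = ∫⁻ s, J (w s) s ∂m := by
  have hvar := Measure.variation_withDensityᵥ hw
  have hu := isPolarDensity_polarDensity (hRN _ (withDensityᵥ_mem_finiteVariationMeasures hw))
  set ν := m.withDensityᵥ w
  set u := polarDensity ν
  have hwm : AEMeasurable (fun s => ‖w s‖ₑ) m := hw.1.enorm
  have hwfin : ∀ᵐ s ∂m, ‖w s‖ₑ < ∞ := Eventually.of_forall fun s => enorm_lt_top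
  have hui : Integrable u (m.withDensity fun s => ‖w s‖ₑ) := hvar ▸ hu.1
  have hint : Integrable (fun s => (‖w s‖ₑ).toReal • u s) m :=
    (integrable_withDensity_iff_integrable_smul₀' hwm hwfin).1 hui
  -- As `|ν| = ‖w‖ m`, both sides are densities of `ν` with respect to `m`; homogeneity then absorbs
  -- the factor `‖w‖`.
  have hae : (fun s => (‖w s‖ₑ).toReal • u s) =ᵐ[m] w := by
    refine hint.ae_eq_of_withDensityᵥ_eq hw ?_
    rw [withDensityᵥ_smul_eq_withDensityᵥ_withDensity' hwm hwfin hint, ← hvar, hu.withDensityᵥ_eq]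
  have hJu : AEMeasurable (fun s => J (u s) s) (m.withDensity fun s => ‖w s‖ₑ) :=
    hJmeas.comp_aemeasurable (hui.1.aemeasurable.prodMk aemeasurable_id)
  rw [lifted, hvar, lintegral_withDensity_eq_lintegral_mul₀' hwm hJu]
  refine lintegral_congr_ae ?_
  filter_upwards [hae] with s hs
  rw [← hs, apply_smul_of_nonneg hJhom ENNReal.toReal_nonneg, ENNReal.ofReal_toReal enorm_ne_top]
  rfl

/-- Negative `c` is allowed, where homogeneity of `J` says nothing; this serves to compare opposite
directions at `0`. -/
theorem lifted_smul_eq_lintegral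
    (hRN : ∀ μ ∈ finiteVariationMeasures Ω X, ∃ u, IsPolarDensity μ u)
    (hJmeas : Measurable fun p : X × Ω => J p.1 p.2)
    (hJhom : ∀ (c : ℝ≥0) (v : X) (s : Ω), J (c • v) s = c * J v s)
    (hμ : μ ∈ finiteVariationMeasures Ω X) (c : ℝ) :
    lifted J (c • μ) = ∫⁻ s, J (c • polarDensity μ s) s ∂μ.variation := by
  have hu := isPolarDensity_polarDensity (hRN μ hμ)
  conv_lhs => rw [← hu.withDensityᵥ_eq, ← withDensityᵥ_smul]
  exact lifted_withDensityᵥ hRN hJmeas hJhom (hu.1.smul c)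

theorem lifted_smul (hRN : ∀ μ ∈ finiteVariationMeasures Ω X, ∃ u, IsPolarDensity μ u)
    (hJmeas : Measurable fun p : X × Ω => J p.1 p.2)
    (hJhom : ∀ (c : ℝ≥0) (v : X) (s : Ω), J (c • v) s = c * J v s)
    (hμ : μ ∈ finiteVariationMeasures Ω X) {c : ℝ} (hc : 0 ≤ c) :
    lifted J (c • μ) = ENNReal.ofReal c * lifted J μ := by
  rw [lifted_smul_eq_lintegral hRN hJmeas hJhom hμ, lifted,
    ← lintegral_const_mul' _ _ ENNReal.ofReal_ne_top]
  exact lintegral_congr fun s => apply_smul_of_nonneg hJhom hc _ _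

theorem lifted_restrict (hRN : ∀ μ ∈ finiteVariationMeasures Ω X, ∃ u, IsPolarDensity μ u)
    (hJmeas : Measurable fun p : X × Ω => J p.1 p.2)
    (hJhom : ∀ (c : ℝ≥0) (v : X) (s : Ω), J (c • v) s = c * J v s)
    (hμ : μ ∈ finiteVariationMeasures Ω X) {A : Set Ω} (hA : MeasurableSet A) :
    lifted J (μ.restrict A) = ∫⁻ s in A, J (polarDensity μ s) s ∂μ.variation := by
  have hu := isPolarDensity_polarDensity (hRN μ hμ)
  have : μ.restrict A = (μ.variation.restrict A).withDensityᵥ (polarDensity μ) := by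
    ext t ht
    rw [VectorMeasure.restrict_apply _ hA ht, withDensityᵥ_apply hu.1.integrableOn ht,
      hu.2 _ (ht.inter hA), Measure.restrict_restrict ht]
  rw [this, lifted_withDensityᵥ hRN hJmeas hJhom hu.1.integrableOn]

theorem lifted_restrict_add_restrict_compl
    (hRN : ∀ μ ∈ finiteVariationMeasures Ω X, ∃ u, IsPolarDensity μ u)
    (hJmeas : Measurable fun p : X × Ω => J p.1 p.2)
    (hJhom : ∀ (c : ℝ≥0) (v : X) (s : Ω), J (c • v) s = c * J v s)
    (hμ : μ ∈ finiteVariationMeasures Ω X) {A : Set Ω} (hA : MeasurableSet A) :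
    lifted J (μ.restrict A) + lifted J (μ.restrict Aᶜ) = lifted J μ := by
  rw [lifted_restrict hRN hJmeas hJhom hμ hA, lifted_restrict hRN hJmeas hJhom hμ hA.compl,
    lintegral_add_compl _ hA, lifted]

theorem lifted_dirac [MeasurableSingletonClass Ω]
    (hRN : ∀ μ ∈ finiteVariationMeasures Ω X, ∃ u, IsPolarDensity μ u)
    (hJmeas : Measurable fun p : X × Ω => J p.1 p.2)
    (hJhom : ∀ (c : ℝ≥0) (v : X) (s : Ω), J (c • v) s = c * J v s) (r : Ω) (v : X) :
    lifted J (VectorMeasure.dirac r v) = J v r := by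
  rw [dirac_eq_withDensityᵥ, lifted_withDensityᵥ hRN hJmeas hJhom (integrable_const v),
    lintegral_dirac]

end Lifted

/-! ### Extreme points of the balls -/

section ExtremePoints

/-- A nonzero extreme point of a unit ball has gauge exactly one. -/
theorem eq_one_of_mem_extremePoints {V : Type*} [AddCommGroup V] [Module ℝ V] {B : Set V}
    {v : V} {a : ℝ≥0∞} (hv : v ∈ B.extremePoints ℝ) (hv0 : v ≠ 0)
    (hB : ∀ c : ℝ, 0 ≤ c → ENNReal.ofReal c * a ≤ 1 → c • v ∈ B) (ha : a ≤ 1) (ha0 : a ≠ 0) :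
    a = 1 := by
  by_contra ha1
  have hfin : a ≠ ∞ := ne_top_of_le_ne_top ENNReal.one_ne_top ha
  have hpos : 0 < a.toReal := ENNReal.toReal_pos ha0 hfin
  have hlt : a.toReal < 1 := by
    rw [← ENNReal.toReal_one]
    exact (ENNReal.toReal_lt_toReal hfin ENNReal.one_ne_top).2 (lt_of_le_of_ne ha ha1)
  have h0 : (0 : V) ∈ B := by
    simpa using hB 0 le_rfl (by simp)
  have h1 : a.toReal⁻¹ • v ∈ B := by
    refine hB _ (inv_nonneg.2 hpos.le) ?_
    rw [ENNReal.ofReal_inv_of_pos hpos, ENNReal.ofReal_toReal hfin,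
      ENNReal.inv_mul_cancel ha0 hfin]
  -- If `0 < a < 1`, then `v = (1 - a) • 0 + a • (a⁻¹ • v)`.
  refine hv0 (hv.2 h0 h1 ⟨1 - a.toReal, a.toReal, by linarith, hpos, by ring, ?_⟩).symm
  rw [smul_zero, zero_add, smul_smul, mul_inv_cancel₀ hpos.ne', one_smul]

variable {Ω X : Type*} [NormedAddCommGroup X] [NormedSpace ℝ X]
  {J : X → Ω → ℝ≥0∞} {α : ℝ}

theorem smul_mem_ball_iff (hJhom : ∀ (c : ℝ≥0) (v : X) (s : Ω), J (c • v) s = c * J v s)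
    {c : ℝ} (hc : 0 ≤ c) {v : X} {s : Ω} :
    c • v ∈ ball α J s ↔ ENNReal.ofReal c * (ENNReal.ofReal α * J v s) ≤ 1 := by
  change ENNReal.ofReal α * J (c • v) s ≤ 1 ↔ _
  rw [apply_smul_of_nonneg hJhom hc, mul_left_comm]

theorem gauge_eq_one_of_mem_extremePoints_ball
    (hJhom : ∀ (c : ℝ≥0) (v : X) (s : Ω), J (c • v) s = c * J v s)
    (hJ0 : ∀ v s, J v s = 0 → v = 0) (hα : 0 < α) {v : X} {s : Ω}
    (hv : v ∈ (ball α J s).extremePoints ℝ) (hv0 : v ≠ 0) : ENNReal.ofReal α * J v s = 1 :=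
  eq_one_of_mem_extremePoints hv hv0 (fun _ hc h => (smul_mem_ball_iff hJhom hc).2 h) hv.1
    (mul_ne_zero (ENNReal.ofReal_pos.2 hα).ne' fun h => hv0 (hJ0 _ _ h))

/-- If `0` is an extreme point of the ball, then `J` is not finite at both `v` and `-v` for
`v ≠ 0`. -/
theorem eq_zero_of_apply_ne_top (hJhom : ∀ (c : ℝ≥0) (v : X) (s : Ω), J (c • v) s = c * J v s)
    {s : Ω} (h0 : (0 : X) ∈ (ball α J s).extremePoints ℝ) {v : X} {c : ℝ} (hc : c < 0)
    (h1 : J v s ≠ ∞) (h2 : J (c • v) s ≠ ∞) : v = 0 := by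
  obtain ⟨t, ht0, ht1, ht2⟩ : ∃ t : ℝ, 0 < t ∧
      ENNReal.ofReal t * (ENNReal.ofReal α * J v s) ≤ 1 ∧
      ENNReal.ofReal t * (ENNReal.ofReal α * J (c • v) s) ≤ 1 := by
    have hM : ENNReal.ofReal α * J v s + ENNReal.ofReal α * J (c • v) s ≠ ∞ := by finiteness
    set M := ENNReal.ofReal α * J v s + ENNReal.ofReal α * J (c • v) s
    -- The scale is `t = 1 / (M + 1)`; the `+ 1` avoids dividing by zero.
    have hM' : (0 : ℝ) < M.toReal + 1 := by positivity
    have key : ∀ x ≤ M, ENNReal.ofReal (M.toReal + 1)⁻¹ * x ≤ 1 := by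
      intro x hx
      rw [ENNReal.ofReal_inv_of_pos hM', ENNReal.ofReal_add ENNReal.toReal_nonneg zero_le_one,
        ENNReal.ofReal_toReal hM, ENNReal.ofReal_one]
      calc (M + 1)⁻¹ * x ≤ (M + 1)⁻¹ * (M + 1) := by gcongr; exact hx.trans le_self_add
        _ ≤ 1 := ENNReal.inv_mul_le_one _
    exact ⟨_, inv_pos.2 hM', key _ le_self_add, key _ le_add_self⟩
  have hd : 0 < 1 - c := by linarith
  -- The weights `-c / (1 - c)` and `1 / (1 - c)` balance `t • v` against `t • c • v` at `0`.
  have h := h0.2 ((smul_mem_ball_iff hJhom ht0.le).2 ht1) ((smul_mem_ball_iff hJhom ht0.le).2 ht2)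
    ⟨-c / (1 - c), 1 / (1 - c), div_pos (by linarith) hd, by positivity, by field_simp; ring, by
      rw [smul_smul, smul_smul, smul_smul, ← add_smul]
      convert zero_smul ℝ v using 2
      ring⟩
  exact (smul_eq_zero.1 h).resolve_left ht0.ne'

variable [MeasurableSpace Ω]

theorem dirac_smul (r : Ω) (c : ℝ) (v : X) :
    VectorMeasure.dirac r (c • v) = c • VectorMeasure.dirac r v := by
  ext t ht
  by_cases h : r ∈ t <;> simp [h, ht]

theorem dirac_mem_openSegment (r : Ω) {v v₁ v₂ : X} (h : v ∈ openSegment ℝ v₁ v₂) :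
    VectorMeasure.dirac r v ∈
      openSegment ℝ (VectorMeasure.dirac r v₁) (VectorMeasure.dirac r v₂) := by
  obtain ⟨a, b, ha, hb, hab, rfl⟩ := h
  exact ⟨a, b, ha, hb, hab, by rw [dirac_add, dirac_smul, dirac_smul]⟩

variable [CompleteSpace X] [MeasurableSpace X] [BorelSpace X]

theorem dirac_mem_liftedBall_iff [MeasurableSingletonClass Ω]
    (hRN : ∀ μ ∈ finiteVariationMeasures Ω X, ∃ u, IsPolarDensity μ u)
    (hJmeas : Measurable fun p : X × Ω => J p.1 p.2)
    (hJhom : ∀ (c : ℝ≥0) (v : X) (s : Ω), J (c • v) s = c * J v s) {r : Ω} {v : X} :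
    VectorMeasure.dirac r v ∈ liftedBall α J ↔ v ∈ ball α J r := by
  change _ ∧ ENNReal.ofReal α * lifted J _ ≤ 1 ↔ ENNReal.ofReal α * J v r ≤ 1
  rw [lifted_dirac hRN hJmeas hJhom]
  exact and_iff_right (dirac_mem_finiteVariationMeasures r v)

theorem mem_extremePoints_ball_of_dirac [MeasurableSingletonClass Ω]
    (hRN : ∀ μ ∈ finiteVariationMeasures Ω X, ∃ u, IsPolarDensity μ u)
    (hJmeas : Measurable fun p : X × Ω => J p.1 p.2)
    (hJhom : ∀ (c : ℝ≥0) (v : X) (s : Ω), J (c • v) s = c * J v s) {r : Ω} {v : X}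
    (h : VectorMeasure.dirac r v ∈ (liftedBall α J).extremePoints ℝ) :
    v ∈ (ball α J r).extremePoints ℝ := by
  have hiff := fun w => dirac_mem_liftedBall_iff (α := α) (r := r) (v := w) hRN hJmeas hJhom
  refine ⟨(hiff v).1 h.1, fun v₁ h₁ v₂ h₂ hv => ?_⟩
  have := h.2 ((hiff v₁).2 h₁) ((hiff v₂).2 h₂) (dirac_mem_openSegment r hv)
  simpa using congrArg (fun ν : VectorMeasure Ω X => ν {r}) this

/-- A nonzero extreme point of the lifted ball is concentrated at a point. -/
theorem exists_eq_dirac_of_mem_extremePoints [StandardBorelSpace Ω]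
    (hRN : ∀ μ ∈ finiteVariationMeasures Ω X, ∃ u, IsPolarDensity μ u)
    (hJmeas : Measurable fun p : X × Ω => J p.1 p.2)
    (hJhom : ∀ (c : ℝ≥0) (v : X) (s : Ω), J (c • v) s = c * J v s)
    (hJ0 : ∀ v s, J v s = 0 → v = 0) (hα : 0 < α) {μ : VectorMeasure Ω X}
    (hμ : μ ∈ (liftedBall α J).extremePoints ℝ) (hμ0 : μ ≠ 0) :
    ∃ r v, μ = VectorMeasure.dirac r v := by
  have hfv : μ ∈ finiteVariationMeasures Ω X := hμ.1.1
  have hα' : ENNReal.ofReal α ≠ 0 := (ENNReal.ofReal_pos.2 hα).ne'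
  have hsmul : ∀ ν ∈ finiteVariationMeasures Ω X, ∀ c : ℝ, 0 ≤ c →
      ENNReal.ofReal c * (ENNReal.ofReal α * lifted J ν) ≤ 1 → c • ν ∈ liftedBall α J := by
    intro ν hν c hc h
    refine ⟨smul_mem_finiteVariationMeasures hν c, ?_⟩
    rwa [lifted_smul hRN hJmeas hJhom hν hc, mul_left_comm]
  have hone : ENNReal.ofReal α * lifted J μ = 1 :=
    eq_one_of_mem_extremePoints hμ hμ0 (hsmul μ hfv) hμ.1.2
      (mul_ne_zero hα' fun h => hμ0 (eq_zero_of_lifted_eq_zero hRN hJmeas hJ0 hfv h))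
  let m : Measure Ω := ENNReal.ofReal α •
    μ.variation.withDensity fun s => J (polarDensity μ s) s
  have hm : ∀ A, MeasurableSet A → m A = ENNReal.ofReal α * lifted J (μ.restrict A) := by
    intro A hA
    rw [lifted_restrict hRN hJmeas hJhom hfv hA, ← withDensity_apply _ hA]
    rfl
  have hadd : ∀ A, MeasurableSet A → m A + m Aᶜ = 1 := by
    intro A hA
    rw [hm A hA, hm _ hA.compl, ← mul_add,
      lifted_restrict_add_restrict_compl hRN hJmeas hJhom hfv hA, hone]
  have hrestrict : ∀ A, MeasurableSet A → m A = 0 → μ.restrict A = 0 := by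
    intro A hA h
    rw [hm A hA] at h
    exact eq_zero_of_lifted_eq_zero hRN hJmeas hJ0 (restrict_mem_finiteVariationMeasures hfv A)
      ((mul_eq_zero.1 h).resolve_left hα')
  have hzo : ∀ A, MeasurableSet A → m A = 0 ∨ m A = 1 := by
    intro A hA
    by_contra! hne
    have hs := hadd A hA
    have hfin : m A ≠ ∞ := ne_top_of_le_ne_top ENNReal.one_ne_top (hs ▸ le_self_add)
    have hfin' : m Aᶜ ≠ ∞ := ne_top_of_le_ne_top ENNReal.one_ne_top (hs ▸ le_add_self)
    have hc0 : m Aᶜ ≠ 0 := fun h => hne.2 (by rwa [h, add_zero] at hs)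
    have hp : 0 < (m A).toReal := ENNReal.toReal_pos hne.1 hfin
    have hp' : 0 < (m Aᶜ).toReal := ENNReal.toReal_pos hc0 hfin'
    have hsr : (m A).toReal + (m Aᶜ).toReal = 1 := by
      rw [← ENNReal.toReal_add hfin hfin', hs, ENNReal.toReal_one]
    have hmem : ∀ C, MeasurableSet C → m C ≠ 0 → m C ≠ ∞ →
        (m C).toReal⁻¹ • μ.restrict C ∈ liftedBall α J := by
      intro C hC h0 h1
      have hpos := ENNReal.toReal_pos h0 h1
      refine hsmul _ (restrict_mem_finiteVariationMeasures hfv C) _ (inv_nonneg.2 hpos.le) ?_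
      rw [← hm C hC, ENNReal.ofReal_inv_of_pos hpos, ENNReal.ofReal_toReal h1,
        ENNReal.inv_mul_cancel h0 h1]
    have heq := hμ.2 (hmem A hA hne.1 hfin) (hmem _ hA.compl hc0 hfin')
      ⟨_, _, hp, hp', hsr, by
        rw [smul_smul, smul_smul, mul_inv_cancel₀ hp.ne', mul_inv_cancel₀ hp'.ne', one_smul,
          one_smul, restrict_add_restrict_compl μ hA]⟩
    -- By extremality `μ` is a multiple of its restriction to `A`, hence vanishes off `A`.
    have hz : μ.restrict Aᶜ = 0 := by
      ext t ht
      rw [VectorMeasure.restrict_apply _ hA.compl ht, ← heq, _root_.smul_apply,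
        VectorMeasure.restrict_apply _ hA (ht.inter hA.compl), Set.inter_assoc,
        Set.compl_inter_self, Set.inter_empty, VectorMeasure.empty, smul_zero,
        _root_.zero_apply]
    refine hc0 ?_
    rw [hm _ hA.compl, hz]
    simp [lifted]
  have : IsZeroOneMeasure m := ⟨fun A hA => hzo A hA⟩
  have : NeZero m := ⟨fun h => by simpa [h] using hadd Set.univ MeasurableSet.univ⟩
  -- This is where the standard Borel structure enters.
  obtain ⟨r, hr⟩ := IsZeroOneMeasure.exists_eq_dirac (μ := m)
  have hr0 : μ.restrict {r}ᶜ = 0 :=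
    hrestrict _ (measurableSet_singleton r).compl (by rw [hr]; simp)
  refine ⟨r, μ {r}, ?_⟩
  conv_lhs => rw [← restrict_add_restrict_compl μ (measurableSet_singleton r), hr0, add_zero]
  exact restrict_singleton μ r

/-- If a measure of the lifted ball has an atom of gauge one, it is concentrated there. -/
theorem eq_dirac_of_gauge_eq_one [MeasurableSingletonClass Ω]
    (hRN : ∀ μ ∈ finiteVariationMeasures Ω X, ∃ u, IsPolarDensity μ u)
    (hJmeas : Measurable fun p : X × Ω => J p.1 p.2)
    (hJhom : ∀ (c : ℝ≥0) (v : X) (s : Ω), J (c • v) s = c * J v s)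
    (hJ0 : ∀ v s, J v s = 0 → v = 0) (hα : 0 < α) {μ : VectorMeasure Ω X}
    (hμ : μ ∈ liftedBall α J) {r : Ω} (h : ENNReal.ofReal α * J (μ {r}) r = 1) :
    μ = VectorMeasure.dirac r (μ {r}) := by
  have hr := measurableSet_singleton r
  have h1 : ENNReal.ofReal α * lifted J μ ≤ 1 := hμ.2
  rw [← lifted_restrict_add_restrict_compl hRN hJmeas hJhom hμ.1 hr, restrict_singleton,
    lifted_dirac hRN hJmeas hJhom, mul_add, h] at h1
  have h2 : ENNReal.ofReal α * lifted J (μ.restrict {r}ᶜ) = 0 := by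
    have : (1 : ℝ≥0∞) + ENNReal.ofReal α * lifted J (μ.restrict {r}ᶜ) ≤ 1 + 0 := by
      rwa [add_zero]
    exact le_zero_iff.1 ((ENNReal.add_le_add_iff_left ENNReal.one_ne_top).1 this)
  have h3 := eq_zero_of_lifted_eq_zero hRN hJmeas hJ0
    (restrict_mem_finiteVariationMeasures hμ.1 {r}ᶜ)
    ((mul_eq_zero.1 h2).resolve_left (ENNReal.ofReal_pos.2 hα).ne')
  conv_lhs => rw [← restrict_add_restrict_compl μ hr, h3, add_zero]
  exact restrict_singleton μ r

theorem apply_singleton_mem_ball [MeasurableSingletonClass Ω]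
    (hRN : ∀ μ ∈ finiteVariationMeasures Ω X, ∃ u, IsPolarDensity μ u)
    (hJmeas : Measurable fun p : X × Ω => J p.1 p.2)
    (hJhom : ∀ (c : ℝ≥0) (v : X) (s : Ω), J (c • v) s = c * J v s)
    {μ : VectorMeasure Ω X} (hμ : μ ∈ liftedBall α J) (r : Ω) : μ {r} ∈ ball α J r := by
  have h1 : ENNReal.ofReal α * lifted J μ ≤ 1 := hμ.2
  rw [← lifted_restrict_add_restrict_compl hRN hJmeas hJhom hμ.1 (measurableSet_singleton r),
    restrict_singleton, lifted_dirac hRN hJmeas hJhom, mul_add] at h1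
  exact le_self_add.trans h1

theorem dirac_mem_extremePoints [MeasurableSingletonClass Ω]
    (hRN : ∀ μ ∈ finiteVariationMeasures Ω X, ∃ u, IsPolarDensity μ u)
    (hJmeas : Measurable fun p : X × Ω => J p.1 p.2)
    (hJhom : ∀ (c : ℝ≥0) (v : X) (s : Ω), J (c • v) s = c * J v s)
    (hJ0 : ∀ v s, J v s = 0 → v = 0) (hα : 0 < α) {r : Ω} {v : X}
    (hv : v ∈ (ball α J r).extremePoints ℝ) (hv0 : v ≠ 0) :
    VectorMeasure.dirac r v ∈ (liftedBall α J).extremePoints ℝ := by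
  have hg := gauge_eq_one_of_mem_extremePoints_ball hJhom hJ0 hα hv hv0
  refine ⟨(dirac_mem_liftedBall_iff hRN hJmeas hJhom).2 hv.1, fun μ₁ h₁ μ₂ h₂ h => ?_⟩
  have hv1 : μ₁ {r} = v := by
    refine hv.2 (apply_singleton_mem_ball hRN hJmeas hJhom h₁ r)
      (apply_singleton_mem_ball hRN hJmeas hJhom h₂ r) ?_
    obtain ⟨a, b, ha, hb, hab, h⟩ := h
    exact ⟨a, b, ha, hb, hab, by
      simpa using congrArg (fun ν : VectorMeasure Ω X => ν {r}) h⟩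
  rw [← hv1] at hg
  rw [eq_dirac_of_gauge_eq_one hRN hJmeas hJhom hJ0 hα h₁ hg, hv1]

/-- If `0` is an extreme point of all the balls, then it is an extreme point of the lifted ball. -/
theorem zero_mem_extremePoints_liftedBall
    (hRN : ∀ μ ∈ finiteVariationMeasures Ω X, ∃ u, IsPolarDensity μ u)
    (hJmeas : Measurable fun p : X × Ω => J p.1 p.2)
    (hJhom : ∀ (c : ℝ≥0) (v : X) (s : Ω), J (c • v) s = c * J v s) (hα : 0 < α)
    (h0 : ∀ r, (0 : X) ∈ (ball α J r).extremePoints ℝ) :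
    (0 : VectorMeasure Ω X) ∈ (liftedBall α J).extremePoints ℝ := by
  refine ⟨⟨by simp [finiteVariationMeasures], by simp [lifted]⟩, fun μ₁ h₁ μ₂ h₂ h => ?_⟩
  obtain ⟨a, b, ha, hb, hab, h⟩ := h
  -- Both measures thus share one density up to a negative factor, and finite gauges make `J` finite
  -- almost everywhere in both directions.
  have hμ₂ : μ₂ = (-(a / b)) • μ₁ := by
    have h' : b • μ₂ = (-a) • μ₁ := by
      rw [neg_smul]
      exact eq_neg_of_add_eq_zero_right h
    rw [← inv_smul_smul₀ hb.ne' μ₂, h', smul_smul]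
    congr 1
    ring
  have hfin : ∀ x : ℝ≥0∞, ENNReal.ofReal α * x ≤ 1 → x ≠ ∞ := by
    rintro x hx rfl
    rw [ENNReal.mul_top (ENNReal.ofReal_pos.2 hα).ne'] at hx
    exact absurd hx (by simp)
  have hf1 := hfin _ h₁.2
  have hf2 := hfin _ h₂.2
  rw [← one_smul ℝ μ₁, lifted_smul_eq_lintegral hRN hJmeas hJhom h₁.1] at hf1
  rw [hμ₂, lifted_smul_eq_lintegral hRN hJmeas hJhom h₁.1] at hf2
  refine eq_zero_of_polarDensity_ae_eq_zero hRN h₁.1 ?_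
  filter_upwards [ae_lt_top' (aemeasurable_apply_polarDensity hRN hJmeas h₁.1 _) hf1,
    ae_lt_top' (aemeasurable_apply_polarDensity hRN hJmeas h₁.1 _) hf2] with s hs1 hs2
  rw [one_smul] at hs1
  exact eq_zero_of_apply_ne_top hJhom (h0 s) (neg_lt_zero.2 (div_pos ha hb)) hs1.ne hs2.ne

end ExtremePoints

end InfConv

/-! ### The characterization -/

theorem mainTheorem3
    {E X : Type*} [NormedAddCommGroup E] [NormedSpace ℝ E] [CompleteSpace E]
    [NormedAddCommGroup X] [NormedSpace ℝ X] [CompleteSpace X]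
    [TopologicalSpace.SeparableSpace X] [MeasurableSpace X] [BorelSpace X]
    (e : X ≃ₗᵢ[ℝ] StrongDual ℝ E)
    (d : ℕ) (S : Set (EuclideanSpace ℝ (Fin d))) (hScompact : IsCompact S) (hSne : S.Nonempty)
    (J : X → S → ℝ≥0∞)
    (hJmeas : Measurable (fun p : X × S => J p.1 p.2))
    (hJproper : ∀ s, ∃ v, J v s ≠ ∞)
    (hJconvex : ∀ s, ConvexOn ℝ≥0 Set.univ (fun v => J v s))
    (hJhom : ∀ (c : ℝ≥0) (v : X) (s : S), J (c • v) s = c * J v s)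
    (hJlsc : ∀ (v : ℕ → X) (w : X) (s : ℕ → S) (t : S),
      InfConv.WeakStarTendsto e v w → Tendsto s atTop (𝓝 t) →
        J w t ≤ liminf (fun n => J (v n) (s n)) atTop)
    (hJcoercive : ∃ C : ℝ≥0, 0 < C ∧ ∀ (v : X) (s : S), ‖v‖ₑ ≤ C * J v s)
    (α : ℝ) (hα : 0 < α) :
    ((∀ r : S, (0 : X) ∈ (InfConv.ball α J r).extremePoints ℝ) →
      (InfConv.liftedBall α J).extremePoints ℝ =
        {μ | ∃ r : S, ∃ v ∈ (InfConv.ball α J r).extremePoints ℝ,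
          μ = VectorMeasure.dirac r v}) ∧
    ((∃ r : S, (0 : X) ∉ (InfConv.ball α J r).extremePoints ℝ) →
      (InfConv.liftedBall α J).extremePoints ℝ =
        {μ | ∃ r : S, ∃ v ∈ (InfConv.ball α J r).extremePoints ℝ \ {0},
          μ = VectorMeasure.dirac r v}) := by
  have hRN := fun μ hμ => InfConv.exists_isPolarDensity (Ω := S) e μ hμ
  have hJ0 : ∀ v s, J v s = 0 → v = 0 := by
    intro v s h
    obtain ⟨C, -, hC⟩ := hJcoercive
    simpa [h] using hC v s
  have : StandardBorelSpace S := hScompact.isClosed.measurableSet.standardBorel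
  have hforward : ∀ μ ∈ (InfConv.liftedBall α J).extremePoints ℝ, μ ≠ 0 →
      ∃ r : S, ∃ v ∈ (InfConv.ball α J r).extremePoints ℝ \ {0},
        μ = VectorMeasure.dirac r v := by
    intro μ hμ hμ0
    obtain ⟨r, v, rfl⟩ :=
      InfConv.exists_eq_dirac_of_mem_extremePoints hRN hJmeas hJhom hJ0 hα hμ hμ0
    refine ⟨r, v, ⟨InfConv.mem_extremePoints_ball_of_dirac hRN hJmeas hJhom hμ, ?_⟩, rfl⟩
    rintro rfl
    exact hμ0 VectorMeasure.dirac_zero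
  constructor
  · intro h0
    ext μ
    constructor
    · intro hμ
      by_cases hμ0 : μ = 0
      · obtain ⟨r, hr⟩ := hSne
        exact ⟨⟨r, hr⟩, 0, h0 _, by rw [hμ0, VectorMeasure.dirac_zero]⟩
      · obtain ⟨r, v, hv, rfl⟩ := hforward μ hμ hμ0
        exact ⟨r, v, hv.1, rfl⟩
    · rintro ⟨r, v, hv, rfl⟩
      by_cases hv0 : v = 0
      · rw [hv0, VectorMeasure.dirac_zero]
        exact InfConv.zero_mem_extremePoints_liftedBall hRN hJmeas hJhom hα h0
      · exact InfConv.dirac_mem_extremePoints hRN hJmeas hJhom hJ0 hα hv hv0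
  · rintro ⟨r₀, hr₀⟩
    ext μ
    constructor
    · intro hμ
      refine hforward μ hμ ?_
      rintro rfl
      -- Reading `0` as a Dirac mass at `r₀` would make it extreme in the ball at `r₀`.
      rw [← VectorMeasure.dirac_zero (x := r₀)] at hμ
      exact hr₀ (InfConv.mem_extremePoints_ball_of_dirac hRN hJmeas hJhom hμ)
    · rintro ⟨r, v, hv, rfl⟩
      exact InfConv.dirac_mem_extremePoints hRN hJmeas hJhom hJ0 hα hv.1 hv.2
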